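/- **Characterization of the minimal Taylor resolution.** Let $k$ be a field, let $S$ be a polynomial ring over $k$ in finitely many variables, and let $\mathfrak m$ be the ideal of $S$ generated by the variables. Let $M$ be a monomial ideal of $S$ whose minimal generating set $G=\{m_1,\dots,m_q\}$ consists of $q$ distinct monomials. The following statements are equivalent: 1. The Taylor resolution $\mathbb T_M$ of $S/M$ is minimal. Here $\mathbb T_M$ has in homological degree $j$ the free $S$-module with basis the symbols $[m_{r_1},\dots,m_{r_j}]$, $r_1<\dots<r_j$, and differentials $$f_j\big([m_{r_1},\dots,m_{r_j}]\big)=\sum_{i=1}^{j}(-1)^{i+1}\,\frac{\operatorname{lcm}(m_{r_1},\dots,m_{r_j})}{\operatorname{lcm}(m_{r_1},\dots,\widehat{m_{r_i}},\dots,m_{r_j})}\,[m_{r_1},\dots,\widehat{m_{r_i}},\dots,m_{r_j}];$$ a complex $F_\bullet$ is minimal if each differential maps $F_j$ into $\mathfrak m F_{j-1}$. 2. $M$ is dominant: for every $m\in G$ there are a variable $x$ and an integer $e>0$ such that $x^e\mid m$ and $x^e\nmid m'$ for all $m'\in G\setminus\{m\}$. 3. $\beta_i(S/M)=\binom{q}{i}$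 for all $i\ge 0$, where $\beta_i(S/M)=\dim_k\operatorname{Tor}_i^S(S/M,k)$ with $k=S/\mathfrak m$. 4. $\operatorname{pd}_S(S/M)=q$. 5. $M\neq S$ and the LCM lattice of $M$ is Boolean. That is, the set of least common multiples of the subsets of $G$ (with $\operatorname{lcm}(\emptyset)=1$), ordered by divisibility, is isomorphic to the lattice of all subsets of some finite set. -/

import Mathlib

open CategoryTheory MvPolynomial

universe u v

noncomputable section

namespace TaylorMinimality

/-- The ideal of `k[σ]` generated by the monomials whose exponent vectors lie in `G`. -/
def monomialSpan (k : Type u) [Field k] {σ : Type v} (G : Set (σ →₀ ℕ)) :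
    Ideal (MvPolynomial σ k) :=
  Ideal.span ((fun a => monomial a (1 : k)) '' G)

/-- `G` (a set of monomials, written as exponent vectors) generates the ideal `M`, and no proper
subset of `G` does. -/
def IsMinimalGeneratingSet {k : Type u} [Field k] {σ : Type v} (G : Set (σ →₀ ℕ))
    (M : Ideal (MvPolynomial σ k)) : Prop :=
  monomialSpan k G = M ∧ ∀ G' : Set (σ →₀ ℕ), G' ⊂ G → monomialSpan k G' ≠ M

/-- The variable `x` is dominant for the monomial `a` with respect to `G`: some positive power
`x ^ e` divides `a` but divides no other member of `G`. -/
def IsDominantVariable {σ : Type v} (G : Set (σ →₀ ℕ)) (a : σ →₀ ℕ) (x : σ) : Prop :=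
  ∃ e : ℕ, 0 < e ∧ e ≤ a x ∧ ∀ b ∈ G, b ≠ a → ¬ e ≤ b x

/-- Every monomial of `G` has a dominant variable with respect to `G`. -/
def IsDominantSet {σ : Type v} (G : Set (σ →₀ ℕ)) : Prop :=
  ∀ a ∈ G, ∃ x, IsDominantVariable G a x

/-- A monomial ideal is dominant if its (unique) minimal set of monomial generators is. -/
def IsDominantIdeal {k : Type u} [Field k] {σ : Type v} (M : Ideal (MvPolynomial σ k)) : Prop :=
  ∃ G : Set (σ →₀ ℕ), IsMinimalGeneratingSet G M ∧ IsDominantSet G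

/-- The least common multiples of the finite subsets of the minimal generating set of `M`; the
lcm of the empty set is `1`, that is, the exponent vector `0`. -/
def lcmSet {k : Type u} [Field k] {σ : Type v} (M : Ideal (MvPolynomial σ k)) :
    Set (σ →₀ ℕ) :=
  {a | ∃ G : Set (σ →₀ ℕ), IsMinimalGeneratingSet G M ∧
    ∃ s : Finset (σ →₀ ℕ), (s : Set (σ →₀ ℕ)) ⊆ G ∧ s.sup id = a}

/-- The LCM lattice of `M`, ordered by divisibility of monomials (the order of exponent vectors). -/
abbrev LcmLattice {k : Type u} [Field k] {σ : Type v} (M : Ideal (MvPolynomial σ k)) : Type v :=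
  {a : σ →₀ ℕ // a ∈ lcmSet M}

/-- A (finite) partially ordered set is a Boolean lattice if it is isomorphic to the lattice of all
subsets of some finite set. -/
def IsBooleanLattice (P : Type v) [PartialOrder P] : Prop :=
  ∃ n : ℕ, Nonempty (P ≃o Finset (Fin n))

/-! ### The Taylor resolution -/

/-- The multidegree of the face `s`: the exponent vector of the lcm of the `m i`, `i ∈ s`. -/
def mdeg {σ : Type v} {q : ℕ} (m : Fin q → σ →₀ ℕ) (s : Finset (Fin q)) : σ →₀ ℕ :=
  s.sup m

/-- The faces with `j` vertices of the full simplex on `Fin q`. -/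
abbrev Face (q j : ℕ) : Type := {s : Finset (Fin q) // s.card = j}

/-- The face obtained by deleting a vertex. -/
def Face.del {q j : ℕ} (s : Face q (j + 1)) (i : {i // i ∈ s.1}) : Face q j :=
  ⟨s.1.erase i.1, by rw [Finset.card_erase_of_mem i.2, s.2]; rfl⟩

/-- The coefficient of the facet `s \ {i}` in the differential of `s`: the quotient of the two
multidegrees, with sign `(-1) ^ (number of vertices of s before i)`. -/
def taylorCoeff (k : Type u) [Field k] {σ : Type v} {q : ℕ} (m : Fin q → σ →₀ ℕ)
    (s : Finset (Fin q)) (i : Fin q) : MvPolynomial σ k :=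
  (-1) ^ (s.filter (· < i)).card * monomial (mdeg m s - mdeg m (s.erase i)) 1

/-- The differential from homological degree `j + 1` to homological degree `j`. -/
def taylorD (k : Type u) [Field k] {σ : Type v} {q : ℕ} (m : Fin q → σ →₀ ℕ) (j : ℕ) :
    (Face q (j + 1) →₀ MvPolynomial σ k) →ₗ[MvPolynomial σ k] (Face q j →₀ MvPolynomial σ k) :=
  Finsupp.linearCombination (MvPolynomial σ k) fun s : Face q (j + 1) =>
    ∑ i : {i // i ∈ s.1}, Finsupp.single (s.del i) (taylorCoeff k m s.1 i.1)

lemma mdeg_mono {σ : Type v} {q : ℕ} (m : Fin q → σ →₀ ℕ) {s t : Finset (Fin q)} (h : s ⊆ t) :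
    mdeg m s ≤ mdeg m t := Finset.sup_mono h

lemma sign_swap {k : Type u} [Field k] {σ : Type v} {q : ℕ} (s : Finset (Fin q)) {i j : Fin q}
    (hi : i ∈ s) (hij : i < j) :
    ((-1) ^ (s.filter (· < i)).card * (-1) ^ ((s.erase i).filter (· < j)).card : MvPolynomial σ k)
      + (-1) ^ (s.filter (· < j)).card * (-1) ^ ((s.erase j).filter (· < i)).card = 0 := by
  have h1 : (s.erase j).filter (· < i) = s.filter (· < i) := by
    ext x; simp only [Finset.mem_filter, Finset.mem_erase]
    constructor
    · rintro ⟨⟨_, h⟩, h'⟩; exact ⟨h, h'⟩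
    · rintro ⟨h, h'⟩; exact ⟨⟨(h'.trans hij).ne, h⟩, h'⟩
  have h2 : (s.erase i).filter (· < j) = (s.filter (· < j)).erase i := by
    rw [Finset.filter_erase]
  have h3 : (s.filter (· < j)).card = ((s.filter (· < j)).erase i).card + 1 := by
    rw [Finset.card_erase_add_one]; simp [hi, hij]
  rw [h1, h2, h3]; ring

lemma coeff_swap (k : Type u) [Field k] {σ : Type v} {q : ℕ} (m : Fin q → σ →₀ ℕ)
    (s : Finset (Fin q)) {i j : Fin q} (hi : i ∈ s) (hj : j ∈ s) (hij : i ≠ j) :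
    taylorCoeff k m s i * taylorCoeff k m (s.erase i) j
      + taylorCoeff k m s j * taylorCoeff k m (s.erase j) i = 0 := by
  have key : ∀ i j : Fin q, taylorCoeff k m s i * taylorCoeff k m (s.erase i) j =
      ((-1) ^ (s.filter (· < i)).card * (-1) ^ ((s.erase i).filter (· < j)).card)
        * monomial (mdeg m s - mdeg m ((s.erase i).erase j)) 1 := by
    intro i j
    have e : mdeg m s - mdeg m ((s.erase i).erase j) =
        (mdeg m s - mdeg m (s.erase i)) + (mdeg m (s.erase i) - mdeg m ((s.erase i).erase j)) := by
      rw [tsub_add_tsub_cancel (mdeg_mono m (Finset.erase_subset _ _))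
        (mdeg_mono m (Finset.erase_subset _ _))]
    have e' : (monomial (mdeg m s - mdeg m ((s.erase i).erase j)) (1 : k)) =
        monomial (mdeg m s - mdeg m (s.erase i)) 1 *
          monomial (mdeg m (s.erase i) - mdeg m ((s.erase i).erase j)) 1 := by
      rw [monomial_mul, one_mul, ← e]
    rw [e']
    simp only [taylorCoeff]; ring
  rw [key i j, key j i, Finset.erase_right_comm (a := j) (b := i), ← add_mul]
  rcases lt_or_gt_of_ne hij with h | h
  · rw [sign_swap s hi h, zero_mul]
  · rw [add_comm, sign_swap s hj h, zero_mul]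

lemma taylorD_comp (k : Type u) [Field k] {σ : Type v} {q : ℕ} (m : Fin q → σ →₀ ℕ) (j : ℕ) :
    taylorD k m j ∘ₗ taylorD k m (j + 1) = 0 := by
  refine Finsupp.lhom_ext' fun s => LinearMap.ext_ring ?_
  simp only [LinearMap.comp_apply, Finsupp.lsingle_apply, taylorD,
    Finsupp.linearCombination_single, one_smul, map_sum, Finset.smul_sum, Finsupp.smul_single,
    smul_eq_mul, LinearMap.zero_apply]
  rw [Finset.sum_sigma']
  refine Finset.sum_involution
    (fun x _ => ⟨⟨x.2.1, Finset.mem_of_mem_erase x.2.2⟩, ⟨x.1.1, by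
      exact Finset.mem_erase.2 ⟨(Finset.ne_of_mem_erase x.2.2).symm, x.1.2⟩⟩⟩) ?_ ?_ ?_ ?_
  · rintro ⟨⟨a, ha⟩, ⟨b, hb⟩⟩ _
    have hb' : b ∈ s.1.erase a := hb
    have e : (Face.del (Face.del s ⟨a, ha⟩) ⟨b, hb⟩) =
        (Face.del (Face.del s ⟨b, Finset.mem_of_mem_erase hb'⟩) ⟨a, Finset.mem_erase.2
          ⟨(Finset.ne_of_mem_erase hb').symm, ha⟩⟩) :=
      Subtype.ext (Finset.erase_right_comm)
    dsimp only
    rw [e, ← Finsupp.single_add]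
    refine (congrArg _ ?_).trans (Finsupp.single_zero _)
    exact coeff_swap k m s.1 ha (Finset.mem_of_mem_erase hb') (Finset.ne_of_mem_erase hb').symm
  · rintro ⟨⟨a, ha⟩, ⟨b, hb⟩⟩ _ _ h
    have hb' : b ∈ s.1.erase a := hb
    have h1 := congrArg (fun x => x.1.1) h
    exact Finset.ne_of_mem_erase hb' h1
  · intros; exact Finset.mem_sigma.2 ⟨Finset.mem_univ _, Finset.mem_univ _⟩
  · intros; rfl

/-- The Taylor resolution on the monomials `m 0, …, m (q - 1)`: the free module in homological
degree `j` has the faces with `j` vertices as a basis. -/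
def taylorComplex (k : Type u) [Field k] {σ : Type v} {q : ℕ} (m : Fin q → σ →₀ ℕ) :
    ChainComplex (ModuleCat.{max u v} (MvPolynomial σ k)) ℕ :=
  ChainComplex.of (fun j => ModuleCat.of (MvPolynomial σ k) (Face q j →₀ MvPolynomial σ k))
    (fun j => ModuleCat.ofHom (taylorD k m j))
    (fun j => by rw [← ModuleCat.ofHom_comp, taylorD_comp]; rfl)

/-- The homogeneous maximal ideal generated by the variables. -/
def irrelevantIdeal (k : Type u) [Field k] (σ : Type v) : Ideal (MvPolynomial σ k) :=
  Ideal.span (Set.range X)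

/-- A complex of modules over `k[σ]` is minimal if every differential `F i ⟶ F j` has its image in
`𝔪 F j`, where `𝔪` is the ideal generated by the variables. -/
def IsMinimalComplex {k : Type u} [Field k] {σ : Type v}
    (F : ChainComplex (ModuleCat.{max u v} (MvPolynomial σ k)) ℕ) : Prop :=
  ∀ i j : ℕ, LinearMap.range (F.d i j).hom ≤
    irrelevantIdeal k σ • (⊤ : Submodule (MvPolynomial σ k) (F.X j))

/-! ### Homological invariants of `S/M` -/

/-- The quotient `S/M` as an object of the category of `S`-modules, `S = k[σ]`. -/
abbrev quotientModule {k : Type u} [Field k] {σ : Type v} (M : Ideal (MvPolynomial σ k)) :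
    ModuleCat.{max u v} (MvPolynomial σ k) :=
  ModuleCat.of (MvPolynomial σ k) (MvPolynomial σ k ⧸ M)

/-- The `i`-th total Betti number of `S/M`, the dimension over `k` of `Tor_i^S (S/M, k)`, where
`k = S/𝔪` (the Tor functor `Tor'` derives the tensor product in its first variable). -/
def bettiNumber {k : Type u} [Field k] {σ : Type v} (M : Ideal (MvPolynomial σ k)) (i : ℕ) :
    Cardinal.{max u v} :=
  Module.rank k ((ModuleCat.restrictScalars (C : k →+* MvPolynomial σ k)).obj
    (((Tor' (ModuleCat.{max u v} (MvPolynomial σ k)) i).obj (quotientModule M)).obj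
      (quotientModule (irrelevantIdeal k σ))))

end TaylorMinimality

end

noncomputable section

namespace TaylorMinimality

/-! ### Monomial ideals and their minimal generating sets -/

/-! All five conditions are compared with one combinatorial statement, `LcmIndependent`: no
generator divides the lcm of the others. Dominance is this statement read one variable at a time,
since exponents of an lcm are maxima.

The Taylor complex is always a free resolution. In a fixed multidegree `a` it is the augmented chain
complex of the simplex on the generators dividing `a`, and coning from the first such generator
contracts it (`homotopy_identity`). Its coefficients are signed monomials, and the coefficient of `s
\ {i}` is a unit exactly when `m i` divides the lcm of the rest of `s`. So independence means
minimality, and the top differential alone detects a failure.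

If independence fails, a unit entry makes the top differential a split injection
(`exists_retraction_taylorD_iff`). Splitting off the top term gives `pd < q`, and tensoring with the
residue field gives `Tor_q = 0`. If independence holds, the tensored complex has zero differentials,
so the Betti numbers are the ranks `q.choose i`; the top differential does not split, so `pd = q`.

For the lattice, independence makes taking the lcm an order embedding of the subsets. Conversely,
minimal generators other than `1` are distinct atoms, and in a Boolean lattice an atom is never
below a join of other atoms. -/

lemma monomial_mem_monomialSpan {k : Type u} [Field k] {σ : Type v} {G : Set (σ →₀ ℕ)}
    {b : σ →₀ ℕ} : monomial b (1 : k) ∈ monomialSpan k G ↔ ∃ a ∈ G, a ≤ b := by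
  classical
  rw [monomialSpan, mem_ideal_span_monomial_image]
  simp [support_monomial]

lemma IsMinimalGeneratingSet.eq_of_le {k : Type u} [Field k] {σ : Type v} {G : Set (σ →₀ ℕ)}
    {M : Ideal (MvPolynomial σ k)} (h : IsMinimalGeneratingSet G M) {a b : σ →₀ ℕ}
    (ha : a ∈ G) (hb : b ∈ G) (hab : a ≤ b) : a = b := by
  by_contra hne
  refine h.2 (G \ {b}) (Set.sdiff_singleton_ssubset.2 hb) ?_
  refine le_antisymm ?_ ?_
  · rw [← h.1]
    exact Ideal.span_mono (Set.image_mono Set.sdiff_subset)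
  · rw [← h.1]
    refine Ideal.span_le.2 ?_
    rintro _ ⟨c, hc, rfl⟩
    refine monomial_mem_monomialSpan.2 ?_
    by_cases hcb : c = b
    · exact ⟨a, ⟨ha, hne⟩, hab.trans hcb.ge⟩
    · exact ⟨c, ⟨hc, hcb⟩, le_rfl⟩

/-- A generator in `G` is divisible by one in `G'`, which is in turn divisible by one in `G`; since
`G` is an antichain, all three coincide. -/
lemma IsMinimalGeneratingSet.subset {k : Type u} [Field k] {σ : Type v} {G G' : Set (σ →₀ ℕ)}
    {M : Ideal (MvPolynomial σ k)} (h : IsMinimalGeneratingSet G M)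
    (h' : IsMinimalGeneratingSet G' M) : G ⊆ G' := by
  intro a ha
  have h1 : monomial a (1 : k) ∈ monomialSpan k G' := by
    rw [h'.1, ← h.1]
    exact monomial_mem_monomialSpan.2 ⟨a, ha, le_rfl⟩
  obtain ⟨b, hb, hba⟩ := monomial_mem_monomialSpan.1 h1
  have h2 : monomial b (1 : k) ∈ monomialSpan k G := by
    rw [h.1, ← h'.1]
    exact monomial_mem_monomialSpan.2 ⟨b, hb, le_rfl⟩
  obtain ⟨c, hc, hcb⟩ := monomial_mem_monomialSpan.1 h2
  have hca := h.eq_of_le hc ha (hcb.trans hba)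
  rwa [le_antisymm (hca.symm.le.trans hcb) hba]

lemma IsMinimalGeneratingSet.unique {k : Type u} [Field k] {σ : Type v} {G G' : Set (σ →₀ ℕ)}
    {M : Ideal (MvPolynomial σ k)} (h : IsMinimalGeneratingSet G M)
    (h' : IsMinimalGeneratingSet G' M) : G = G' :=
  (h.subset h').antisymm (h'.subset h)

/-! ### Dominance and lcms of faces -/

/-- No member of the family divides the lcm of the others. -/
def LcmIndependent {σ : Type v} {q : ℕ} (m : Fin q → σ →₀ ℕ) : Prop :=
  ∀ i, ¬ m i ≤ mdeg m (Finset.univ.erase i)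

lemma le_mdeg {σ : Type v} {q : ℕ} (m : Fin q → σ →₀ ℕ) {s : Finset (Fin q)} {i : Fin q}
    (hi : i ∈ s) : m i ≤ mdeg m s :=
  Finset.le_sup (f := m) hi

lemma mdeg_le_iff {σ : Type v} {q : ℕ} {m : Fin q → σ →₀ ℕ} {s : Finset (Fin q)}
    {a : σ →₀ ℕ} : mdeg m s ≤ a ↔ ∀ i ∈ s, m i ≤ a :=
  Finset.sup_le_iff

lemma exists_of_le_mdeg_apply {σ : Type v} {q : ℕ} (m : Fin q → σ →₀ ℕ) {s : Finset (Fin q)}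
    {x : σ} {e : ℕ} (he : 0 < e) (h : e ≤ mdeg m s x) : ∃ j ∈ s, e ≤ m j x := by
  classical
  by_contra! hlt
  -- If every exponent at `x` is below `e`, lowering the lcm's exponent there to `e - 1` still gives
  -- a common multiple, contradicting leastness.
  have hle : mdeg m s ≤ (mdeg m s).update x (e - 1) := by
    refine mdeg_le_iff.2 fun j hj y => ?_
    by_cases hy : y = x
    · subst hy
      simpa using Nat.le_sub_one_of_lt (hlt j hj)
    · simpa [Finsupp.update, Function.update_of_ne hy] using le_mdeg m hj y
  have := hle x
  simp at this
  omega

lemma isDominantSet_range_iff {σ : Type v} {q : ℕ} {m : Fin q → σ →₀ ℕ}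
    (hm : Function.Injective m) : IsDominantSet (Set.range m) ↔ LcmIndependent m := by
  constructor
  · intro h i hi
    obtain ⟨x, e, he, hex, hlt⟩ := h (m i) ⟨i, rfl⟩
    obtain ⟨j, hj, hej⟩ := exists_of_le_mdeg_apply m he (hex.trans (hi x))
    exact hlt (m j) ⟨j, rfl⟩ (hm.ne (Finset.ne_of_mem_erase hj)) hej
  · rintro h _ ⟨i, rfl⟩
    have := h i
    rw [Finsupp.le_def] at this
    push Not at this
    obtain ⟨x, hx⟩ := this
    -- At `x` the exponent of `m i` strictly exceeds that of the lcm of the others, so it is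
    -- positive and serves as `e`.
    refine ⟨x, m i x, by omega, le_rfl, ?_⟩
    rintro _ ⟨j, rfl⟩ hne hle
    have hj : j ∈ Finset.univ.erase i :=
      Finset.mem_erase.2 ⟨fun h => hne (h ▸ rfl), Finset.mem_univ _⟩
    have := le_mdeg m hj x
    omega

lemma isDominantIdeal_iff {k : Type u} [Field k] {σ : Type v} {M : Ideal (MvPolynomial σ k)}
    {q : ℕ} {m : Fin q → σ →₀ ℕ} (hm : Function.Injective m)
    (hM : IsMinimalGeneratingSet (Set.range m) M) : IsDominantIdeal M ↔ LcmIndependent m := by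
  rw [← isDominantSet_range_iff hm]
  refine ⟨?_, fun h => ⟨_, hM, h⟩⟩
  rintro ⟨G, hG, h⟩
  rwa [hM.unique hG]

lemma LcmIndependent.mem_of_le {σ : Type v} {q : ℕ} {m : Fin q → σ →₀ ℕ} (h : LcmIndependent m)
    {s : Finset (Fin q)} {i : Fin q} (hi : m i ≤ mdeg m s) : i ∈ s := by
  by_contra his
  exact h i (hi.trans (mdeg_mono m fun j hj =>
    Finset.mem_erase.2 ⟨fun e => his (e ▸ hj), Finset.mem_univ _⟩))

lemma LcmIndependent.mdeg_le_mdeg_iff {σ : Type v} {q : ℕ} {m : Fin q → σ →₀ ℕ}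
    (h : LcmIndependent m) {s t : Finset (Fin q)} : mdeg m s ≤ mdeg m t ↔ s ⊆ t :=
  ⟨fun hst _ hi => h.mem_of_le ((le_mdeg m hi).trans hst), mdeg_mono m⟩

/-! ### The LCM lattice -/

lemma mem_lcmSet_iff {k : Type u} [Field k] {σ : Type v} {M : Ideal (MvPolynomial σ k)}
    {q : ℕ} {m : Fin q → σ →₀ ℕ} (hM : IsMinimalGeneratingSet (Set.range m) M) {a : σ →₀ ℕ} :
    a ∈ lcmSet M ↔ ∃ s : Finset (Fin q), mdeg m s = a := by
  classical
  constructor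
  · rintro ⟨G, hG, s, hs, rfl⟩
    rw [← hM.unique hG] at hs
    refine ⟨Finset.univ.filter fun i => m i ∈ s, le_antisymm ?_ ?_⟩
    · refine mdeg_le_iff.2 fun i hi => ?_
      exact Finset.le_sup (f := id) (Finset.mem_filter.1 hi).2
    · refine Finset.sup_le fun a ha => ?_
      obtain ⟨i, rfl⟩ := hs ha
      exact le_mdeg m (by simpa using ha)
  · rintro ⟨s, rfl⟩
    refine ⟨_, hM, s.image m, ?_, ?_⟩
    · simp
    · rw [Finset.sup_image]
      rfl

lemma LcmIndependent.isBooleanLattice {k : Type u} [Field k] {σ : Type v}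
    {M : Ideal (MvPolynomial σ k)} {q : ℕ} {m : Fin q → σ →₀ ℕ}
    (hM : IsMinimalGeneratingSet (Set.range m) M) (h : LcmIndependent m) :
    IsBooleanLattice (LcmLattice M) := by
  refine ⟨q, ⟨OrderIso.symm (RelIso.ofSurjective
    (OrderEmbedding.ofMapLEIff (fun s : Finset (Fin q) =>
      (⟨mdeg m s, (mem_lcmSet_iff hM).2 ⟨s, rfl⟩⟩ : LcmLattice M)) ?_) ?_)⟩⟩
  · intro s t
    exact h.mdeg_le_mdeg_iff
  · rintro ⟨a, ha⟩
    obtain ⟨s, rfl⟩ := (mem_lcmSet_iff hM).1 ha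
    exact ⟨s, rfl⟩

lemma eq_top_iff_exists_eq_zero {k : Type u} [Field k] {σ : Type v}
    {M : Ideal (MvPolynomial σ k)} {q : ℕ} {m : Fin q → σ →₀ ℕ}
    (hM : IsMinimalGeneratingSet (Set.range m) M) : M = ⊤ ↔ ∃ i, m i = 0 := by
  have h1 : M = ⊤ ↔ monomial 0 (1 : k) ∈ M := Ideal.eq_top_iff_one M
  rw [h1, ← hM.1, monomial_mem_monomialSpan]
  simp

lemma LcmIndependent.ne_zero {σ : Type v} {q : ℕ} {m : Fin q → σ →₀ ℕ} (h : LcmIndependent m)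
    (i : Fin q) : m i ≠ 0 :=
  fun e => h i (e ▸ zero_le)

/-- Properness of the ideal is essential: for the unit ideal the only generator is `1`, whose lcm
lattice is a point, hence Boolean, while `1` divides the empty lcm. -/
lemma lcmIndependent_of_isBooleanLattice {k : Type u} [Field k] {σ : Type v}
    {M : Ideal (MvPolynomial σ k)} {q : ℕ} {m : Fin q → σ →₀ ℕ} (hm : Function.Injective m)
    (hM : IsMinimalGeneratingSet (Set.range m) M) (hne : M ≠ ⊤)
    (h : IsBooleanLattice (LcmLattice M)) : LcmIndependent m := by
  classical
  obtain ⟨n, ⟨φ⟩⟩ := h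
  have h0 : ∀ i, m i ≠ 0 := fun i hi => hne ((eq_top_iff_exists_eq_zero hM).2 ⟨i, hi⟩)
  let g : Finset (Fin q) → LcmLattice M := fun s => ⟨mdeg m s, (mem_lcmSet_iff hM).2 ⟨s, rfl⟩⟩
  have hg : ∀ b, ∃ s, g s = b := fun ⟨b, hb⟩ => by
    obtain ⟨s, rfl⟩ := (mem_lcmSet_iff hM).1 hb
    exact ⟨s, rfl⟩
  have hgs : ∀ i, (g {i}).1 = m i := fun i => Finset.sup_singleton
  have hg_le : ∀ s b, g s ≤ b ↔ ∀ i ∈ s, g {i} ≤ b := fun s b => by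
    simp only [← Subtype.coe_le_coe, hgs]
    exact mdeg_le_iff
  have hempty : φ (g ∅) = ∅ := by
    rw [← Finset.subset_empty, ← φ.le_symm_apply, hg_le]
    simp
  -- each generator is an atom of the lattice
  have hatom : ∀ i, ∃ c, φ (g {i}) = {c} := by
    intro i
    have hnon : (φ (g {i})).Nonempty := by
      rw [Finset.nonempty_iff_ne_empty, ← hempty]
      intro e
      apply h0 i
      have := congrArg Subtype.val (φ.injective e)
      rw [hgs] at this
      exact this
    obtain ⟨c, hc⟩ := hnon
    refine ⟨c, ?_⟩
    -- The element corresponding to `{c}` is the lcm of a nonempty set of generators, all dividing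
    -- `m i`; minimality makes each of them equal to `m i`.
    obtain ⟨s, hs⟩ := hg (φ.symm {c})
    have hle : g s ≤ g {i} := by
      rw [hs, φ.symm_apply_le]
      simpa using hc
    have hsne : s.Nonempty := by
      rw [Finset.nonempty_iff_ne_empty]
      rintro rfl
      have : φ (g ∅) = {c} := by rw [hs]; simp
      rw [hempty] at this
      exact Finset.singleton_ne_empty _ this.symm
    obtain ⟨j, hj⟩ := hsne
    have hjs : g {j} ≤ g s := (hg_le s _).1 le_rfl j hj
    have hji : m j = m i := hM.eq_of_le ⟨j, rfl⟩ ⟨i, rfl⟩ (by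
      have := hjs.trans hle
      rwa [← Subtype.coe_le_coe, hgs, hgs] at this)
    have : g s = g {i} := le_antisymm hle (by rwa [hm hji] at hjs)
    rw [← this, hs]
    simp
  choose f hf using hatom
  have hfi : Function.Injective f := by
    intro i j hij
    have : φ (g {i}) = φ (g {j}) := by rw [hf, hf, hij]
    have := congrArg Subtype.val (φ.injective this)
    rw [hgs, hgs] at this
    exact hm this
  intro i hi
  have h1 : g {i} ≤ g (Finset.univ.erase i) := by
    rw [← Subtype.coe_le_coe, hgs]
    exact hi
  have h2 : g (Finset.univ.erase i) ≤ φ.symm ((Finset.univ.erase i).image f) := by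
    rw [hg_le]
    intro j hj
    rw [φ.le_symm_apply, hf]
    simpa using ⟨j, Finset.ne_of_mem_erase hj, rfl⟩
  have h3 := h1.trans h2
  rw [φ.le_symm_apply, hf] at h3
  simp only [Finset.singleton_subset_iff, Finset.mem_image] at h3
  obtain ⟨j, hj, hji⟩ := h3
  exact Finset.ne_of_mem_erase hj (hfi hji)

/-! ### Exactness of the Taylor complex -/

section

variable (k : Type u) [Field k] {σ : Type v} {q : ℕ} (m : Fin q → σ →₀ ℕ)

/-- The basis element of multidegree `a` supported on the face `s` (zero if `s` does not have `j`
vertices). -/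
def cell (j : ℕ) (a : σ →₀ ℕ) (s : Finset (Fin q)) : Face q j →₀ MvPolynomial σ k :=
  if h : s.card = j then Finsupp.single ⟨s, h⟩ (monomial (a - mdeg m s) 1) else 0

variable {k m}

lemma neg_one_pow_smul (n : ℕ) (p : MvPolynomial σ k) : (-1 : k) ^ n • p = (-1) ^ n * p := by
  rw [Algebra.smul_def, map_pow, map_neg, map_one]

lemma single_monomial_eq_cell {j : ℕ} (s : Face q j) (b : σ →₀ ℕ) :
    Finsupp.single s (monomial b (1 : k)) = cell k m j (b + mdeg m s.1) s.1 := by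
  rw [cell, dif_pos s.2, add_tsub_cancel_right]

lemma taylorD_single {j : ℕ} (s : Face q (j + 1)) (p : MvPolynomial σ k) :
    taylorD k m j (Finsupp.single s p) =
      ∑ i : {i // i ∈ s.1}, Finsupp.single (s.del i) (p * taylorCoeff k m s.1 i.1) := by
  rw [taylorD, Finsupp.linearCombination_single, Finset.smul_sum]
  simp

/-- Within one multidegree the monomial quotients are absorbed, leaving the simplicial boundary with
signs. -/
lemma taylorD_cell {j : ℕ} {a : σ →₀ ℕ} {s : Finset (Fin q)} (hs : s.card = j + 1)
    (ha : mdeg m s ≤ a) : taylorD k m j (cell k m (j + 1) a s) =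
      ∑ i ∈ s, (-1 : k) ^ (s.filter (· < i)).card • cell k m j a (s.erase i) := by
  rw [cell, dif_pos hs, taylorD_single, ← Finset.sum_attach s, Finset.univ_eq_attach]
  refine Finset.sum_congr rfl fun i _ => ?_
  have hc : (s.erase i.1).card = j := by rw [Finset.card_erase_of_mem i.2, hs]; rfl
  rw [cell, dif_pos hc, Finsupp.smul_single, neg_one_pow_smul, taylorCoeff, mul_left_comm,
    monomial_mul, one_mul,
    tsub_add_tsub_cancel ha (mdeg_mono m (Finset.erase_subset _ _))]
  rfl

variable (m) in
/-- `i` is the first index for which `m i` divides the monomial `a`. -/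
def IsPivot (a : σ →₀ ℕ) (i : Fin q) : Prop := m i ≤ a ∧ ∀ j, m j ≤ a → i ≤ j

lemma exists_isPivot {a : σ →₀ ℕ} {i : Fin q} (hi : m i ≤ a) : ∃ i, IsPivot m a i := by
  classical
  have hne : (Finset.univ.filter fun i => m i ≤ a).Nonempty := ⟨i, by simpa using hi⟩
  refine ⟨Finset.min' _ hne, ?_, fun j hj => Finset.min'_le _ _ (by simpa using hj)⟩
  exact (Finset.mem_filter.1 (Finset.min'_mem _ hne)).2

open Classical in
variable (k m) in
/-- The value of the contracting homotopy on the basis element of multidegree `a` supported on the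
face `s`: add the pivot of `a` to `s`. -/
def homotopyCell (j : ℕ) (a : σ →₀ ℕ) (s : Finset (Fin q)) : Face q (j + 1) →₀ MvPolynomial σ k :=
  ∑ i with IsPivot m a i ∧ i ∉ s, cell k m (j + 1) a (insert i s)

lemma IsPivot.homotopyCell_eq {j : ℕ} {a : σ →₀ ℕ} {s : Finset (Fin q)} {i : Fin q}
    (hi : IsPivot m a i) :
    homotopyCell k m j a s = if i ∈ s then 0 else cell k m (j + 1) a (insert i s) := by
  classical
  have huniq : ∀ i', IsPivot m a i' → i' = i := fun i' h =>
    le_antisymm (h.2 i hi.1) (hi.2 i' h.1)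
  rw [homotopyCell]
  split_ifs with his
  · refine Finset.sum_eq_zero fun i' hi' => ?_
    rw [Finset.mem_filter] at hi'
    exact absurd (huniq i' hi'.2.1 ▸ his) hi'.2.2
  · refine Finset.sum_eq_single_of_mem i (by simp [hi, his]) fun i' hi' hne => ?_
    exact absurd (huniq i' (Finset.mem_filter.1 hi').2.1) hne

variable (k m) in
/-- The contracting homotopy of the Taylor complex in positive degrees. -/
def homotopy (j : ℕ) :
    (Face q j →₀ MvPolynomial σ k) →ₗ[k] (Face q (j + 1) →₀ MvPolynomial σ k) :=
  Finsupp.lsum k fun s => (basisMonomials σ k).constr k fun b =>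
    homotopyCell k m j (b + mdeg m s.1) s.1

lemma homotopy_cell {j : ℕ} {a : σ →₀ ℕ} {s : Finset (Fin q)} (hs : s.card = j)
    (ha : mdeg m s ≤ a) : homotopy k m j (cell k m j a s) = homotopyCell k m j a s := by
  rw [cell, dif_pos hs, homotopy, Finsupp.lsum_single]
  have h := (basisMonomials σ k).constr_basis k
    (fun b => homotopyCell k m j (b + mdeg m s) s) (a - mdeg m s)
  rw [coe_basisMonomials] at h
  rw [h, tsub_add_cancel_of_le ha]

/-- The faces whose lcm divides `a` form a full simplex, a cone with apex the pivot `p`. As `p` is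
its least vertex, inserting it carries sign `+1` and flips the sign of every other vertex. -/
lemma homotopy_cell_identity {j : ℕ} {a : σ →₀ ℕ} {s : Finset (Fin q)} (hs : s.card = j + 1)
    (ha : mdeg m s ≤ a) :
    taylorD k m (j + 1) (homotopy k m (j + 1) (cell k m (j + 1) a s)) +
      homotopy k m j (taylorD k m j (cell k m (j + 1) a s)) = cell k m (j + 1) a s := by
  have hle : ∀ i ∈ s, m i ≤ a := mdeg_le_iff.1 ha
  obtain ⟨p, hp⟩ : ∃ i, IsPivot m a i := by
    obtain ⟨i, hi⟩ : s.Nonempty := Finset.card_pos.1 (by omega)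
    exact exists_isPivot (hle i hi)
  have hcard : ∀ i ∈ s, (s.erase i).card = j := fun i hi => by
    rw [Finset.card_erase_of_mem hi, hs]; rfl
  have hdeg : ∀ i, mdeg m (s.erase i) ≤ a := fun i =>
    (mdeg_mono m (Finset.erase_subset _ _)).trans ha
  have hd : homotopy k m j (taylorD k m j (cell k m (j + 1) a s)) =
      ∑ i ∈ s, (-1 : k) ^ (s.filter (· < i)).card • homotopyCell k m j a (s.erase i) := by
    rw [taylorD_cell hs ha, map_sum]
    refine Finset.sum_congr rfl fun i hi => ?_
    rw [map_smul, homotopy_cell (hcard i hi) (hdeg i)]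
  have hlt : s.filter (· < p) = ∅ :=
    Finset.filter_eq_empty_iff.2 fun i hi => not_lt.2 (hp.2 i (hle i hi))
  rw [hd, homotopy_cell hs ha, hp.homotopyCell_eq]
  by_cases hps : p ∈ s
  -- The homotopy kills a face containing `p`, and of its boundary only the facet opposite `p`
  -- survives.
  · rw [if_pos hps, map_zero, zero_add, Finset.sum_eq_single_of_mem p hps]
    · rw [hlt, hp.homotopyCell_eq, if_neg (Finset.notMem_erase p s), Finset.insert_erase hps]
      simp
    · intro i _ hne
      rw [hp.homotopyCell_eq, if_pos (Finset.mem_erase.2 ⟨hne.symm, hps⟩), smul_zero]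
  -- The boundary of the cone over `s` is `s` minus the cone over the boundary of `s`; the latter
  -- cancels the second summand.
  · have hdeg' : mdeg m (insert p s) ≤ a := mdeg_le_iff.2 fun i hi => by
      rcases Finset.mem_insert.1 hi with rfl | hi
      · exact hp.1
      · exact hle i hi
    rw [if_neg hps, taylorD_cell (by rw [Finset.card_insert_of_notMem hps, hs]) hdeg',
      Finset.sum_insert hps, Finset.erase_insert hps, Finset.filter_insert, if_neg (lt_irrefl p),
      hlt, add_assoc, ← Finset.sum_add_distrib, Finset.sum_eq_zero]
    · simp
    · intro i hi
      have hpi : p ≠ i := fun e => hps (e ▸ hi)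
      have hpi' : p < i := lt_of_le_of_ne (hp.2 i (hle i hi)) hpi
      rw [hp.homotopyCell_eq, if_neg fun h => hps (Finset.mem_of_mem_erase h),
        Finset.filter_insert, if_pos hpi', Finset.card_insert_of_notMem (by simp [hps]),
        Finset.erase_insert_of_ne hpi, pow_succ]
      simp

lemma homotopy_identity {j : ℕ} (x : Face q (j + 1) →₀ MvPolynomial σ k) :
    taylorD k m (j + 1) (homotopy k m (j + 1) x) + homotopy k m j (taylorD k m j x) = x := by
  have h : (taylorD k m (j + 1)).restrictScalars k ∘ₗ homotopy k m (j + 1) +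
      homotopy k m j ∘ₗ (taylorD k m j).restrictScalars k = LinearMap.id := by
    -- The homotopy is only `k`-linear, so equality is tested on the `k`-basis of monomials times
    -- faces, each of which is a cell.
    refine Finsupp.lhom_ext' fun s => (basisMonomials σ k).ext fun b => ?_
    simp only [coe_basisMonomials, LinearMap.comp_apply, LinearMap.add_apply,
      Finsupp.lsingle_apply, LinearMap.restrictScalars_apply, LinearMap.id_apply]
    rw [single_monomial_eq_cell (m := m)]
    exact homotopy_cell_identity s.2 le_add_self
  exact LinearMap.congr_fun h x

/-- The Taylor complex is exact in positive degrees. -/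
lemma range_taylorD_succ (j : ℕ) :
    LinearMap.range (taylorD k m (j + 1)) = LinearMap.ker (taylorD k m j) := by
  refine le_antisymm (LinearMap.range_le_ker_iff.2 (taylorD_comp k m j)) fun x hx => ?_
  refine ⟨homotopy k m (j + 1) x, ?_⟩
  conv_rhs => rw [← homotopy_identity (k := k) (m := m) x]
  rw [LinearMap.mem_ker.1 hx, map_zero, add_zero]

instance : Unique (Face q 0) where
  default := ⟨∅, rfl⟩
  uniq s := Subtype.ext (Finset.card_eq_zero.1 s.2)

/-- The augmentation of the Taylor complex. -/
def augmentation (M : Ideal (MvPolynomial σ k)) :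
    (Face q 0 →₀ MvPolynomial σ k) →ₗ[MvPolynomial σ k] MvPolynomial σ k ⧸ M :=
  M.mkQ ∘ₗ Finsupp.lapply default

lemma augmentation_surjective (M : Ideal (MvPolynomial σ k)) :
    Function.Surjective (augmentation (q := q) M) := fun x => by
  obtain ⟨p, rfl⟩ := M.mkQ_surjective x
  exact ⟨Finsupp.single default p, by simp [augmentation]⟩

lemma taylorD_zero_single {i : Fin q} :
    taylorD k m 0 (Finsupp.single ⟨{i}, Finset.card_singleton i⟩ 1) =
      Finsupp.single default (monomial (m i) 1) := by
  rw [taylorD_single]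
  have : Unique {j // j ∈ ({i} : Finset (Fin q))} :=
    ⟨⟨i, Finset.mem_singleton_self i⟩, fun j => Subtype.ext (Finset.mem_singleton.1 j.2)⟩
  rw [Fintype.sum_unique]
  have hd : ((default : {j // j ∈ ({i} : Finset (Fin q))}) : Fin q) = i :=
    Finset.mem_singleton.1 (default : {j // j ∈ ({i} : Finset (Fin q))}).2
  rw [hd, Subsingleton.elim (Face.del _ _) default, taylorCoeff]
  congr 1
  simp [mdeg, Finset.filter_singleton, bot_eq_zero]

lemma range_taylorD_zero {M : Ideal (MvPolynomial σ k)} (hM : monomialSpan k (Set.range m) = M) :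
    LinearMap.range (taylorD k m 0) = LinearMap.ker (augmentation M) := by
  have hsingle : ∀ i, Finsupp.single default (monomial (m i) 1) ∈
      LinearMap.range (taylorD k m 0) := fun i => ⟨_, taylorD_zero_single⟩
  apply le_antisymm
  · rw [LinearMap.range_le_ker_iff]
    refine Finsupp.lhom_ext' fun s => LinearMap.ext_ring ?_
    obtain ⟨s, hs⟩ := s
    obtain ⟨i, rfl⟩ := Finset.card_eq_one.1 hs
    rw [LinearMap.comp_apply, LinearMap.comp_apply, Finsupp.lsingle_apply, taylorD_zero_single]
    simp only [augmentation, LinearMap.comp_apply, Finsupp.lapply_apply, Finsupp.single_eq_same,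
      LinearMap.zero_comp, LinearMap.zero_apply, Submodule.mkQ_apply,
      Submodule.Quotient.mk_eq_zero]
    rw [← hM]
    exact monomial_mem_monomialSpan.2 ⟨m i, ⟨i, rfl⟩, le_rfl⟩
  · intro x hx
    have hle : M ≤ (LinearMap.range (taylorD k m 0)).comap (Finsupp.lsingle default) := by
      rw [← hM, monomialSpan]
      refine Submodule.span_le.2 ?_
      rintro _ ⟨_, ⟨i, rfl⟩, rfl⟩
      exact hsingle i
    have hx' : x default ∈ M := by
      simpa [augmentation, Ideal.Quotient.eq_zero_iff_mem] using hx
    rw [Finsupp.unique_single x]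
    exact hle hx'

end

/-! ### Minimality of the Taylor complex -/

section

variable {k : Type u} [Field k] {σ : Type v} {q : ℕ} {m : Fin q → σ →₀ ℕ}

lemma mem_irrelevantIdeal_iff {p : MvPolynomial σ k} :
    p ∈ irrelevantIdeal k σ ↔ constantCoeff p = 0 := by
  rw [irrelevantIdeal, ← Set.image_univ, mem_ideal_span_X_image, constantCoeff_eq]
  constructor
  · intro h
    by_contra h0
    obtain ⟨i, _, hi⟩ := h 0 (mem_support_iff.2 h0)
    exact hi rfl
  · intro h a ha
    have : a ≠ 0 := fun e => mem_support_iff.1 ha (e ▸ h)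
    obtain ⟨i, hi⟩ := Finsupp.ne_iff.1 this
    exact ⟨i, Set.mem_univ i, hi⟩

lemma apply_mem_of_mem_smul_top {R ι : Type*} [CommRing R] {I : Ideal R} {x : ι →₀ R}
    (hx : x ∈ I • (⊤ : Submodule R (ι →₀ R))) (i : ι) : x i ∈ I := by
  have h : I • (⊤ : Submodule R (ι →₀ R)) ≤ Submodule.comap (Finsupp.lapply i) I :=
    Submodule.smul_le.2 fun r hr y _ => I.mul_mem_right (y i) hr
  exact h hx

lemma taylorCoeff_mem_irrelevantIdeal_iff {s : Finset (Fin q)} {i : Fin q} (hi : i ∈ s) :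
    taylorCoeff k m s i ∈ irrelevantIdeal k σ ↔ ¬ m i ≤ mdeg m (s.erase i) := by
  classical
  have h1 : mdeg m s - mdeg m (s.erase i) = 0 ↔ m i ≤ mdeg m (s.erase i) := by
    rw [tsub_eq_zero_iff_le, mdeg_le_iff]
    refine ⟨fun h => h i hi, fun h j hj => ?_⟩
    by_cases hji : j = i
    · exact hji ▸ h
    · exact le_mdeg m (Finset.mem_erase.2 ⟨hji, hj⟩)
  rw [mem_irrelevantIdeal_iff, ← h1, taylorCoeff, map_mul, map_pow, map_neg, map_one,
    constantCoeff_monomial]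
  simp

lemma taylorCoeff_eq_neg_one_pow {s : Finset (Fin q)} {i : Fin q}
    (h : m i ≤ mdeg m (s.erase i)) :
    taylorCoeff k m s i = (-1) ^ (s.filter (· < i)).card := by
  have h1 : mdeg m s - mdeg m (s.erase i) = 0 := by
    rw [tsub_eq_zero_iff_le, mdeg_le_iff]
    intro j hj
    by_cases hji : j = i
    · exact hji ▸ h
    · exact le_mdeg m (Finset.mem_erase.2 ⟨hji, hj⟩)
  rw [taylorCoeff, h1]
  exact mul_one _

lemma LcmIndependent.not_le_mdeg_erase (h : LcmIndependent m) (s : Finset (Fin q)) (i : Fin q) :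
    ¬ m i ≤ mdeg m (s.erase i) :=
  fun hi => Finset.notMem_erase i s (h.mem_of_le hi)

lemma Face.del_injective {j : ℕ} (s : Face q (j + 1)) : Function.Injective s.del := by
  intro a b hab
  by_contra hne
  have h : s.1.erase a.1 = s.1.erase b.1 := congrArg Subtype.val hab
  have : b.1 ∈ s.1.erase a.1 :=
    Finset.mem_erase.2 ⟨fun e => hne (Subtype.ext e.symm), b.2⟩
  rw [h] at this
  exact Finset.notMem_erase _ _ this

lemma taylorD_single_apply_del {j : ℕ} (s : Face q (j + 1)) (p : MvPolynomial σ k)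
    (i : {i // i ∈ s.1}) :
    taylorD k m j (Finsupp.single s p) (s.del i) = p * taylorCoeff k m s.1 i.1 := by
  rw [taylorD_single, Finsupp.finsetSum_apply, Finset.sum_eq_single_of_mem i (Finset.mem_univ i)]
  · exact Finsupp.single_eq_same
  · intro i' _ hne
    exact Finsupp.single_eq_of_ne fun e => hne (s.del_injective e.symm)

lemma LcmIndependent.range_taylorD_le (h : LcmIndependent m) (j : ℕ) :
    LinearMap.range (taylorD k m j) ≤ irrelevantIdeal k σ •
      (⊤ : Submodule (MvPolynomial σ k) (Face q j →₀ MvPolynomial σ k)) := by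
  rw [taylorD, Finsupp.range_linearCombination, Submodule.span_le]
  rintro _ ⟨s, rfl⟩
  refine Submodule.sum_mem _ fun i _ => ?_
  rw [← mul_one (taylorCoeff k m s.1 i.1), ← smul_eq_mul, ← Finsupp.smul_single]
  exact Submodule.smul_mem_smul ((taylorCoeff_mem_irrelevantIdeal_iff i.2).2
    (h.not_le_mdeg_erase _ _)) Submodule.mem_top

lemma taylorComplex_d (j : ℕ) :
    (taylorComplex k m).d (j + 1) j = ModuleCat.ofHom (taylorD k m j) := by
  exact ChainComplex.of_d
    (fun j => ModuleCat.of (MvPolynomial σ k) (Face q j →₀ MvPolynomial σ k))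
    (fun j => ModuleCat.ofHom (taylorD k m j)) j

/-- The face with all vertices. -/
def Face.full (n : ℕ) : Face (n + 1) (n + 1) := ⟨Finset.univ, Finset.card_fin _⟩

instance (n : ℕ) : Unique (Face (n + 1) (n + 1)) where
  default := Face.full n
  uniq s := Subtype.ext ((Finset.card_eq_iff_eq_univ _).1 (by simp [s.2]))

lemma isMinimalComplex_taylorComplex_iff :
    IsMinimalComplex (taylorComplex k m) ↔ LcmIndependent m := by
  constructor
  · intro h i
    cases q with
    | zero => exact i.elim0
    | succ n =>
      have h1 := h (n + 1) n
      rw [taylorComplex_d] at h1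
      have h2 := h1 (LinearMap.mem_range_self (taylorD k m n) (Finsupp.single (Face.full n) 1))
      have h3 := apply_mem_of_mem_smul_top h2 ((Face.full n).del ⟨i, Finset.mem_univ i⟩)
      rw [taylorD_single_apply_del, one_mul] at h3
      exact (taylorCoeff_mem_irrelevantIdeal_iff (Finset.mem_univ i)).1 h3
  · intro h i j
    by_cases hij : j + 1 = i
    · subst hij
      rw [taylorComplex_d]
      exact h.range_taylorD_le j
    · rw [(taylorComplex k m).shape i j hij]
      rintro _ ⟨x, rfl⟩
      exact Submodule.zero_mem _

/-- The top differential of the Taylor complex is a split injection exactly when the Taylor complex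
is not minimal. -/
lemma exists_retraction_taylorD_iff {n : ℕ} {m : Fin (n + 1) → σ →₀ ℕ} :
    (∃ r, r ∘ₗ taylorD k m n = LinearMap.id) ↔ ¬ LcmIndependent m := by
  constructor
  · rintro ⟨r, hr⟩ h
    have h1 := h.range_taylorD_le (k := k) n
      (LinearMap.mem_range_self _ (Finsupp.single (Face.full n) 1))
    -- A linear retraction preserves `𝔪F`, so it would put the basis element itself, with coordinate
    -- `1`, in `𝔪F`.
    have h2 : r (taylorD k m n (Finsupp.single (Face.full n) 1)) ∈
        irrelevantIdeal k σ • (⊤ : Submodule (MvPolynomial σ k) _) :=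
      Submodule.smul_top_le_comap_smul_top _ r h1
    have h3 := apply_mem_of_mem_smul_top h2 (Face.full n)
    rw [← LinearMap.comp_apply, hr, mem_irrelevantIdeal_iff] at h3
    simp at h3
  · intro h
    simp only [LcmIndependent, not_forall, not_not] at h
    obtain ⟨i, hi⟩ := h
    let c : MvPolynomial σ k := (-1) ^ ((Finset.univ : Finset (Fin (n + 1))).filter (· < i)).card
    -- The top module has rank one, so it suffices to read off the coordinate with unit entry and
    -- multiply by that sign, its own inverse.
    refine ⟨Finsupp.lsingle (Face.full n) ∘ₗ
      (c • Finsupp.lapply ((Face.full n).del ⟨i, Finset.mem_univ i⟩)), ?_⟩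
    refine Finsupp.lhom_ext' fun s => LinearMap.ext_ring ?_
    obtain rfl : s = Face.full n := Subsingleton.elim _ _
    have hc : c * c = 1 := by rw [← mul_pow]; simp
    simp only [LinearMap.comp_apply, LinearMap.smul_apply, Finsupp.lapply_apply,
      Finsupp.lsingle_apply, LinearMap.id_apply, taylorD_single_apply_del, one_mul, smul_eq_mul]
    have h1 : taylorCoeff k m (Face.full n).1 i = c := taylorCoeff_eq_neg_one_pow hi
    rw [h1, hc]

end

/-! ### The projective dimension -/

section

variable {k : Type u} [Field k] {σ : Type v} {q : ℕ} {m : Fin q → σ →₀ ℕ}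

lemma taylorD_injective {n : ℕ} (m : Fin (n + 1) → σ →₀ ℕ) :
    Function.Injective (taylorD k m n) := by
  rw [← LinearMap.ker_eq_bot, ← range_taylorD_succ, eq_bot_iff]
  rintro _ ⟨x, rfl⟩
  have : IsEmpty (Face (n + 1) (n + 1 + 1)) :=
    ⟨fun s => by simpa [s.2] using Finset.card_le_univ s.1⟩
  rw [Subsingleton.elim x 0, map_zero]
  exact Submodule.zero_mem _

variable (k m) in
/-- The cokernel of the differential of the Taylor complex ending in degree `j`. -/
abbrev taylorCoker (j : ℕ) : ModuleCat.{max u v} (MvPolynomial σ k) :=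
  ModuleCat.of (MvPolynomial σ k)
    ((Face q j →₀ MvPolynomial σ k) ⧸ LinearMap.range (taylorD k m j))

lemma exact_mkQ_taylorD (j : ℕ) :
    Function.Exact (taylorD k m j) (LinearMap.range (taylorD k m j)).mkQ :=
  LinearMap.exact_map_mkQ_range _

/-- The short exact sequence linking consecutive cokernels in the Taylor complex. -/
lemma hasProjectiveDimensionLT_taylorCoker_succ_iff (j n : ℕ) :
    HasProjectiveDimensionLT (taylorCoker k m j) (n + 2) ↔
      HasProjectiveDimensionLT (taylorCoker k m (j + 1)) (n + 1) := by
  let f : ((Face q (j + 1) →₀ MvPolynomial σ k) ⧸ LinearMap.range (taylorD k m (j + 1)))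
      →ₗ[MvPolynomial σ k] (Face q j →₀ MvPolynomial σ k) :=
    (LinearMap.range (taylorD k m (j + 1))).liftQ (taylorD k m j) (range_taylorD_succ j).le
  let g := (LinearMap.range (taylorD k m j)).mkQ
  have hf : Function.Injective f := by
    rw [← LinearMap.ker_eq_bot]
    exact Submodule.ker_liftQ_eq_bot _ _ _ (range_taylorD_succ j).ge
  have hfg : LinearMap.range f = LinearMap.ker g := by
    rw [Submodule.range_liftQ, Submodule.ker_mkQ]
  let S := ShortComplex.mk (ModuleCat.ofHom f) (ModuleCat.ofHom g) (by
    rw [← ModuleCat.ofHom_comp, LinearMap.range_le_ker_iff.1 hfg.le]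
    rfl)
  have hS : S.ShortExact :=
    { exact := (ShortComplex.moduleCat_exact_iff_range_eq_ker _).2 hfg
      mono_f := (ModuleCat.mono_iff_injective _).2 hf
      epi_g := (ModuleCat.epi_iff_surjective _).2 (Submodule.mkQ_surjective _) }
  have hP : Projective (ModuleCat.of (MvPolynomial σ k) (Face q j →₀ MvPolynomial σ k)) :=
    ModuleCat.projective_of_categoryTheory_projective _
  exact hS.hasProjectiveDimensionLT_X₃_iff n hP

lemma hasProjectiveDimensionLT_taylorCoker_iff (j n : ℕ) :
    HasProjectiveDimensionLT (taylorCoker k m j) (n + 1) ↔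
      HasProjectiveDimensionLT (taylorCoker k m (j + n)) 1 := by
  induction n generalizing j with
  | zero => rfl
  | succ n ih =>
    rw [hasProjectiveDimensionLT_taylorCoker_succ_iff, ih, add_assoc, add_comm 1 n]

lemma hasProjectiveDimensionLT_quotientModule_iff {M : Ideal (MvPolynomial σ k)}
    (hM : monomialSpan k (Set.range m) = M) (n : ℕ) :
    HasProjectiveDimensionLT (quotientModule M) (n + 1) ↔
      Module.Projective (MvPolynomial σ k)
        ((Face q n →₀ MvPolynomial σ k) ⧸ LinearMap.range (taylorD k m n)) := by
  let e : taylorCoker k m 0 ≅ quotientModule M := LinearEquiv.toModuleIso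
    ((Submodule.quotEquivOfEq _ _ (range_taylorD_zero hM)).trans
      ((augmentation M).quotKerEquivOfSurjective (augmentation_surjective M)))
  have h1 : HasProjectiveDimensionLT (quotientModule M) (n + 1) ↔
      HasProjectiveDimensionLT (taylorCoker k m n) 1 := by
    rw [← zero_add n, ← hasProjectiveDimensionLT_taylorCoker_iff, zero_add]
    exact ⟨fun _ => hasProjectiveDimensionLT_of_iso e.symm _,
      fun _ => hasProjectiveDimensionLT_of_iso e _⟩
  rw [h1, IsProjective.iff_projective]
  exact (projective_iff_hasProjectiveDimensionLE_zero _).symm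

/-- The top differential is injective, so it begins a short exact sequence with free middle term;
the cokernel is projective exactly when this sequence splits. -/
lemma projective_taylorCoker_iff {n : ℕ} {m : Fin (n + 1) → σ →₀ ℕ} :
    Module.Projective (MvPolynomial σ k)
      ((Face (n + 1) n →₀ MvPolynomial σ k) ⧸ LinearMap.range (taylorD k m n)) ↔
      ¬ LcmIndependent m := by
  rw [← exists_retraction_taylorD_iff (k := k)]
  have h : (∃ l, (LinearMap.range (taylorD k m n)).mkQ ∘ₗ l = LinearMap.id) ↔
      ∃ l, l ∘ₗ taylorD k m n = LinearMap.id :=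
    ((exact_mkQ_taylorD (k := k) (m := m) n).split_tfae (taylorD_injective m)
      (Submodule.mkQ_surjective _)).out 0 1
  rw [← h]
  constructor
  · intro _
    exact Module.projective_lifting_property _ _ (Submodule.mkQ_surjective _)
  · rintro ⟨l, hl⟩
    exact Module.Projective.of_split l _ hl

lemma hasProjectiveDimensionLT_quotientModule_add_one {M : Ideal (MvPolynomial σ k)}
    (hM : monomialSpan k (Set.range m) = M) :
    HasProjectiveDimensionLT (quotientModule M) (q + 1) := by
  rw [hasProjectiveDimensionLT_quotientModule_iff hM]
  have : IsEmpty (Face q (q + 1)) :=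
    ⟨fun s => by simpa [s.2] using Finset.card_le_univ s.1⟩
  have h : LinearMap.range (taylorD k m q) = ⊥ := by
    rw [eq_bot_iff]
    rintro _ ⟨x, rfl⟩
    rw [Subsingleton.elim x 0, map_zero]
    exact Submodule.zero_mem _
  exact Module.Projective.of_equiv (Submodule.quotEquivOfEqBot _ h).symm

lemma projectiveDimension_quotientModule_eq_iff {M : Ideal (MvPolynomial σ k)}
    (hM : IsMinimalGeneratingSet (Set.range m) M) :
    projectiveDimension (quotientModule M) = (q : WithBot ℕ∞) ↔ LcmIndependent m := by
  have hle : projectiveDimension (quotientModule M) ≤ (q : WithBot ℕ∞) :=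
    (projectiveDimension_le_iff _ _).2 (hasProjectiveDimensionLT_quotientModule_add_one hM.1)
  rw [← hle.ge_iff_eq, projectiveDimension_ge_iff, not_iff_comm]
  cases q with
  -- With no generators the quotient is nonzero and independence is vacuous; there is no top
  -- differential to examine.
  | zero =>
    rw [hasProjectiveDimensionLT_zero_iff_isZero, ModuleCat.isZero_iff_subsingleton,
      Ideal.Quotient.subsingleton_iff, eq_top_iff_exists_eq_zero hM]
    simp [LcmIndependent]
  | succ n =>
    rw [hasProjectiveDimensionLT_quotientModule_iff hM.1, projective_taylorCoker_iff]

end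

/-! ### Betti numbers -/

section

variable {k : Type u} [Field k] {σ : Type v} {q : ℕ} {m : Fin q → σ →₀ ℕ}

lemma exactAt_taylorComplex_succ (n : ℕ) : (taylorComplex k m).ExactAt (n + 1) := by
  rw [HomologicalComplex.exactAt_iff' _ (n + 1 + 1) (n + 1) n (by simp) (by simp),
    ShortComplex.moduleCat_exact_iff_range_eq_ker]
  change LinearMap.range ((taylorComplex k m).d (n + 1 + 1) (n + 1)).hom =
    LinearMap.ker ((taylorComplex k m).d (n + 1) n).hom
  rw [taylorComplex_d, taylorComplex_d]
  exact range_taylorD_succ n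

instance (n : ℕ) : Projective ((taylorComplex k m).X n) :=
  ModuleCat.projective_of_categoryTheory_projective
    (ModuleCat.of (MvPolynomial σ k) (Face q n →₀ MvPolynomial σ k))

/-- The augmentation of the Taylor complex, as a morphism of complexes. -/
def taylorπ {M : Ideal (MvPolynomial σ k)} (hM : monomialSpan k (Set.range m) = M) :
    taylorComplex k m ⟶ (ChainComplex.single₀ _).obj (quotientModule M) :=
  (ChainComplex.toSingle₀Equiv _ _).symm ⟨ModuleCat.ofHom (augmentation M), by
    rw [taylorComplex_d]
    ext1
    exact LinearMap.range_le_ker_iff.1 (range_taylorD_zero hM).le⟩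

lemma taylorπ_f_zero {M : Ideal (MvPolynomial σ k)} (hM : monomialSpan k (Set.range m) = M) :
    (taylorπ hM).f 0 = ModuleCat.ofHom (augmentation M) :=
  ChainComplex.toSingle₀Equiv_symm_apply_f_zero _ _

/-- The Taylor resolution of `S/M`. -/
def taylorResolution {M : Ideal (MvPolynomial σ k)} (hM : monomialSpan k (Set.range m) = M) :
    ProjectiveResolution (quotientModule M) where
  complex := taylorComplex k m
  projective := inferInstance
  π := taylorπ hM
  quasiIso := ⟨fun n => by
    cases n
    · rw [ChainComplex.quasiIsoAt₀_iff, ShortComplex.quasiIso_iff_of_zeros']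
      · refine (ShortComplex.exact_and_epi_g_iff_of_iso
          (S₂ := ShortComplex.mk (ModuleCat.ofHom (taylorD k m 0))
            (ModuleCat.ofHom (augmentation M)) ?_) ?_).2 ⟨?_, ?_⟩
        · ext1
          exact LinearMap.range_le_ker_iff.1 (range_taylorD_zero hM).le
        · refine ShortComplex.isoMk (Iso.refl _) (Iso.refl _) (Iso.refl _) ?_ ?_
          · exact (Category.id_comp _).trans
              ((taylorComplex_d 0).symm.trans (Category.comp_id _).symm)
          · exact (Category.id_comp _).trans
              ((taylorπ_f_zero hM).symm.trans (Category.comp_id _).symm)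
        · rw [ShortComplex.moduleCat_exact_iff_range_eq_ker]
          exact range_taylorD_zero hM
        · exact (ModuleCat.epi_iff_surjective _).2 (augmentation_surjective M)
      all_goals rfl
    · rw [quasiIsoAt_iff_exactAt']
      · apply exactAt_taylorComplex_succ
      · apply ChainComplex.exactAt_succ_single_obj⟩

variable (k m) in
/-- The Taylor complex tensored with the residue field. -/
def taylorTensor : ChainComplex (ModuleCat.{max u v} (MvPolynomial σ k)) ℕ :=
  (((MonoidalCategory.tensoringRight (ModuleCat.{max u v} (MvPolynomial σ k))).obj
    (quotientModule (irrelevantIdeal k σ))).mapHomologicalComplex _).obj (taylorComplex k m)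

lemma bettiNumber_eq {M : Ideal (MvPolynomial σ k)} (hM : monomialSpan k (Set.range m) = M)
    (i : ℕ) : bettiNumber M i =
      Module.rank k ((ModuleCat.restrictScalars (C : k →+* MvPolynomial σ k)).obj
        ((taylorTensor k m).homology i)) :=
  LinearEquiv.rank_eq (Iso.toLinearEquiv ((ModuleCat.restrictScalars _).mapIso
    ((taylorResolution hM).isoLeftDerivedObj _ i)))

/-- Every functor preserves split monomorphisms, so the top differential stays injective after
tensoring. -/
lemma isZero_homology_taylorTensor {n : ℕ} {m : Fin (n + 1) → σ →₀ ℕ} (h : ¬ LcmIndependent m) :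
    Limits.IsZero ((taylorTensor k m).homology (n + 1)) := by
  obtain ⟨r, hr⟩ := (exists_retraction_taylorD_iff (k := k)).2 h
  have : IsSplitMono ((taylorComplex k m).d (n + 1) n) := by
    rw [taylorComplex_d]
    refine IsSplitMono.mk' ⟨ModuleCat.ofHom r, ?_⟩
    ext1
    exact hr
  have h1 : Mono ((taylorTensor k m).d (n + 1) n) := by
    change Mono (((MonoidalCategory.tensoringRight (ModuleCat.{max u v} (MvPolynomial σ k))).obj
      (quotientModule (irrelevantIdeal k σ))).map ((taylorComplex k m).d (n + 1) n))
    infer_instance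
  rw [← HomologicalComplex.exactAt_iff_isZero_homology,
    HomologicalComplex.exactAt_iff' _ (n + 1 + 1) (n + 1) n (by simp) (by simp)]
  refine (ShortComplex.exact_iff_mono _ ?_).2 h1
  exact (cancel_mono ((taylorTensor k m).d (n + 1) n)).1
    (((taylorTensor k m).d_comp_d _ _ _).trans Limits.zero_comp.symm)

lemma LcmIndependent.taylorTensor_d_eq_zero (h : LcmIndependent m) (i j : ℕ) :
    (taylorTensor k m).d i j = 0 := by
  have hle := isMinimalComplex_taylorComplex_iff (k := k).2 h i j
  change MonoidalCategoryStruct.whiskerRight ((taylorComplex k m).d i j)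
    (quotientModule (irrelevantIdeal k σ)) = 0
  refine ModuleCat.MonoidalCategory.tensor_ext fun x y => ?_
  -- Scalars from `𝔪` move across the tensor sign and annihilate `S/𝔪`.
  have key : ∀ z ∈ irrelevantIdeal k σ •
      (⊤ : Submodule (MvPolynomial σ k) ((taylorComplex k m).X j)),
      TensorProduct.tmul (MvPolynomial σ k) z y = 0 := by
    intro z hz
    induction hz using Submodule.smul_induction_on' with
    | smul r hr z _ =>
      rw [TensorProduct.smul_tmul]
      obtain ⟨p, rfl⟩ := Ideal.Quotient.mk_surjective y
      rw [← Ideal.Quotient.mk_eq_mk, ← Submodule.Quotient.mk_smul,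
        (Submodule.Quotient.mk_eq_zero _).2
          (show r • p ∈ _ from Ideal.mul_mem_right p _ hr), TensorProduct.tmul_zero]
    | add z _ z' _ hz hz' => rw [TensorProduct.add_tmul, hz, hz', add_zero]
  exact key _ (hle (LinearMap.mem_range_self _ x))

lemma rank_residueField :
    Module.rank k (MvPolynomial σ k ⧸ irrelevantIdeal k σ) = 1 := by
  let f : MvPolynomial σ k →ₐ[k] k := aeval 0
  have hf : irrelevantIdeal k σ = RingHom.ker f := by
    ext p
    rw [mem_irrelevantIdeal_iff, RingHom.mem_ker]
    simp [f, aeval_zero]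
  have hs : Function.Surjective f := fun c => ⟨C c, by simp [f]⟩
  have e := ((Ideal.quotientEquivAlgOfEq k hf).trans
    (Ideal.quotientKerAlgEquivOfSurjective hs)).toLinearEquiv
  have := e.lift_rank_eq
  rw [Module.rank_self, Cardinal.lift_one] at this
  exact Cardinal.lift_eq_one.1 this

lemma rank_taylorTensor_X (i : ℕ) :
    Module.rank k ((ModuleCat.restrictScalars (C : k →+* MvPolynomial σ k)).obj
      ((taylorTensor k m).X i)) = (q.choose i : Cardinal) := by
  classical
  let N := MvPolynomial σ k ⧸ irrelevantIdeal k σ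
  let e : (taylorTensor k m).X i ≅ ModuleCat.of (MvPolynomial σ k) (Face q i →₀ N) :=
    LinearEquiv.toModuleIso (TensorProduct.finsuppScalarLeft (MvPolynomial σ k)
      N (Face q i))
  -- The identity map; only the two descriptions of the `k`-action, through `C` and directly, need
  -- comparing.
  let e' : (ModuleCat.restrictScalars (C : k →+* MvPolynomial σ k)).obj
      (ModuleCat.of (MvPolynomial σ k) (Face q i →₀ N)) ≃ₗ[k] (Face q i →₀ N) :=
    { AddEquiv.refl (Face q i →₀ N) with
      map_smul' := fun c x =>
        algebraMap_smul (M := Face q i →₀ N) (MvPolynomial σ k) c x }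
  rw [((Iso.toLinearEquiv ((ModuleCat.restrictScalars _).mapIso e)).trans e').rank_eq,
    rank_finsupp, rank_residueField]
  have : Fintype.card (Face q i) = q.choose i := by
    rw [Fintype.card_finset_len, Fintype.card_fin]
  simp [Cardinal.mk_fintype, this]

lemma LcmIndependent.bettiNumber_eq_choose {M : Ideal (MvPolynomial σ k)}
    (hM : monomialSpan k (Set.range m) = M) (h : LcmIndependent m) (i : ℕ) :
    bettiNumber M i = (q.choose i : Cardinal) := by
  rw [bettiNumber_eq hM, ← rank_taylorTensor_X (k := k) (m := m) i]
  let S := (taylorTensor k m).sc i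
  let e : (taylorTensor k m).homology i ≅ (taylorTensor k m).X i :=
    (ShortComplex.HomologyData.ofZeros S (h.taylorTensor_d_eq_zero _ _)
      (h.taylorTensor_d_eq_zero _ _)).left.homologyIso
  exact (Iso.toLinearEquiv ((ModuleCat.restrictScalars _).mapIso e)).rank_eq

/-- Only the top Betti number is needed: dependence would make `Tor_q` vanish. -/
lemma lcmIndependent_of_bettiNumber {M : Ideal (MvPolynomial σ k)}
    (hM : monomialSpan k (Set.range m) = M) (h : bettiNumber M q = 1) : LcmIndependent m := by
  cases q with
  | zero => exact fun i => i.elim0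
  | succ n =>
    by_contra hm
    have hz := isZero_homology_taylorTensor (k := k) hm
    have hz' := (ModuleCat.restrictScalars (C : k →+* MvPolynomial σ k)).map_isZero hz
    rw [ModuleCat.isZero_iff_subsingleton] at hz'
    rw [bettiNumber_eq hM, rank_subsingleton'] at h
    exact zero_ne_one h

end

end TaylorMinimality

end

theorem corollary4p9 {k : Type u} [Field k] {σ : Type v} [Finite σ]
    (M : Ideal (MvPolynomial σ k)) (q : ℕ) (m : Fin q → σ →₀ ℕ) (hm : Function.Injective m)
    (hM : TaylorMinimality.IsMinimalGeneratingSet (Set.range m) M) :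
    [TaylorMinimality.IsMinimalComplex (TaylorMinimality.taylorComplex k m),
     TaylorMinimality.IsDominantIdeal M,
     ∀ i : ℕ, TaylorMinimality.bettiNumber M i = (q.choose i : Cardinal),
     projectiveDimension (TaylorMinimality.quotientModule M) = (q : WithBot ℕ∞),
     M ≠ ⊤ ∧ TaylorMinimality.IsBooleanLattice (TaylorMinimality.LcmLattice M)].TFAE := by
  rw [TaylorMinimality.isMinimalComplex_taylorComplex_iff,
    TaylorMinimality.isDominantIdeal_iff hm hM,
    TaylorMinimality.projectiveDimension_quotientModule_eq_iff hM]
  tfae_have 1 ↔ 2 := Iff.rfl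
  tfae_have 1 ↔ 4 := Iff.rfl
  tfae_have 1 → 3 := fun h => h.bettiNumber_eq_choose hM.1
  tfae_have 3 → 1 := fun h =>
    TaylorMinimality.lcmIndependent_of_bettiNumber hM.1 (by simp [h q])
  tfae_have 1 → 5 := fun h =>
    ⟨fun e => by
      obtain ⟨i, hi⟩ := (TaylorMinimality.eq_top_iff_exists_eq_zero hM).1 e
      exact h.ne_zero i hi, h.isBooleanLattice hM⟩
  tfae_have 5 → 1 := fun h =>
    TaylorMinimality.lcmIndependent_of_isBooleanLattice hm hM h.1 h.2
  tfae_finish
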